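/- All rings are finite, not necessarily commutative, and have a multiplicative identity; $\mathrm{GF}(q)$ is the field with $q$ elements, and $M_2(\mathrm{GF}(p))$ is the ring of $2\times 2$ matrices over $\mathrm{GF}(p)$. A network is a finite directed acyclic multigraph together with a finite set of messages, where each node generates some set of messages and demands some set of messages (either set may be empty). The inputs of a node are the messages generated at it and the symbols carried by its in-edges. A scalar linear code over a ring $R$ assigns to every edge a function from the inputs of its tail to the symbol it carries, and to every message demanded at a node a decoding function of the inputs of that node, where messages and symbols are elements of $R$ and all these functions have the form $f(x_1,\dots,x_m)=c_1x_1+\cdots+c_mx_m$ with constants $c_1,\dots,c_m\in R$. The network is scalar linearly solvable over $R$ if there is such a code for which, for all values of the messages in $R$, every decoding function returns the demanded message. **Theorem.** Let $p$ be a prime, and suppose that a network $\mathcal N$ is scalar linearly solvable over a ring $R$. (a) If $|R|=p^2$, then $\mathcal N$ is scalar linearly solvable over $\mathrm{GF}(p^2)$. (b) If $|R|=p^3$, then $\mathcal N$ is scalar linearly solvable over $\mathrm{GF}(p^3)$. (c) If $|R|=p^4$, then $\mathcal N$ is scalar linearly solvable over at least one of $\mathrm{GF}(p^4)$ and $M_2(\mathrm{GF}(p))$.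 (d) If $|R|=p^5$, then $\mathcal N$ is scalar linearly solvable over at least one of $\mathrm{GF}(p^5)$ and $\mathrm{GF}(p^3)\times\mathrm{GF}(p^2)$. (e) If $|R|=p^6$, then $\mathcal N$ is scalar linearly solvable over $\mathrm{GF}(p^6)$. -/

import Mathlib

/-- A network: a finite directed acyclic multigraph with vertex set `V` and edge set `E`, a finite
set `M` of messages, and for every node the set of messages that originate there (the node is a
source if this set is nonempty) and the set of messages that it demands (the node is a receiver if
this set is nonempty). -/
structure Network.{u, v, w} where
  V : Type u
  E : Type v
  M : Type w
  finiteV : Finite V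
  finiteE : Finite E
  finiteM : Finite M
  tail : E → V
  head : E → V
  /-- There is no directed cycle (in particular no loop). -/
  acyclic : ∀ v : V,
    ¬ Relation.TransGen (fun a b : V => ∃ e : E, tail e = a ∧ head e = b) v v
  generated : V → Set M
  demanded : V → Set M

namespace Network

attribute [instance] Network.finiteV Network.finiteE Network.finiteM

/-- The inputs of the node `v`: the messages originating at `v` and the in-edges of `v`. -/
abbrev Input (N : Network) (v : N.V) : Type _ :=
  {m : N.M // m ∈ N.generated v} ⊕ {e : N.E // N.head e = v}

noncomputable instance (N : Network) (v : N.V) : Fintype (N.Input v) := Fintype.ofFinite _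

/-- The symbols received by the node `v`, when the messages are `z` and the edges carry `s`. -/
def inputs {A : Type*} (N : Network) (z : N.M → A) (s : N.E → A) (v : N.V) : N.Input v → A :=
  Sum.elim (fun m => z m.1) (fun e => s e.1)

/-- A code over the alphabet `A`: an edge function for every edge, taking the inputs of the tail of
the edge to the symbol it carries, and a decoding function for every demand of every node. -/
structure Code (N : Network) (A : Type*) where
  edgeFun : (e : N.E) → (N.Input (N.tail e) → A) → A
  decodeFun : (v : N.V) → (m : N.M) → m ∈ N.demanded v → (N.Input v → A) → A

/-- When the messages are `z`, the edges carry the symbols `s` in the code `C`. -/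
def Code.Carries {N : Network} {A : Type*} (C : N.Code A) (z : N.M → A) (s : N.E → A) : Prop :=
  ∀ e, s e = C.edgeFun e (N.inputs z s (N.tail e))

/-- As the graph is acyclic, the messages determine the symbols carried by all the edges. -/
theorem Code.existsUnique_carries {N : Network} {A : Type*} (C : N.Code A) (z : N.M → A) :
    ∃! s : N.E → A, C.Carries z s := by
  classical
  let r : N.V → N.V → Prop := Relation.TransGen (fun a b => ∃ e : N.E, N.tail e = a ∧ N.head e = b)
  haveI : IsTrans N.V r := ⟨fun _ _ _ => Relation.TransGen.trans⟩
  haveI : Std.Irrefl r := ⟨N.acyclic⟩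
  have wf : WellFounded r := Finite.wellFounded_of_trans_of_irrefl r
  have wfE : WellFounded (fun e e' : N.E => r (N.tail e) (N.tail e')) := InvImage.wf N.tail wf
  have step : ∀ e e' : N.E, N.head e = N.tail e' → r (N.tail e) (N.tail e') := fun e e' h =>
    Relation.TransGen.single ⟨e, rfl, h⟩
  let F : (e : N.E) → ((e' : N.E) → r (N.tail e') (N.tail e) → A) → A := fun e ih =>
    C.edgeFun e (Sum.elim (fun m => z m.1) (fun e' => ih e'.1 (step e'.1 e e'.2)))
  refine ⟨wfE.fix F, fun e => ?_, fun s hs => ?_⟩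
  · rw [wfE.fix_eq]
    rfl
  · funext e
    induction e using wfE.induction with
    | _ e ih =>
      rw [wfE.fix_eq, hs e]
      refine congrArg (C.edgeFun e) (funext fun i => ?_)
      rcases i with m | e'
      · rfl
      · exact ih e'.1 (step e'.1 e e'.2)

/-- A code is a solution if, for all values of the messages, every node recovers all the messages
that it demands from its inputs. -/
def Code.IsSolution {N : Network} {A : Type*} (C : N.Code A) : Prop :=
  ∀ z : N.M → A, ∃ s : N.E → A, C.Carries z s ∧
    ∀ (v : N.V) (m : N.M) (hm : m ∈ N.demanded v), C.decodeFun v m hm (N.inputs z s v) = z m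

/-- Functions of the form `f (x₁, …, xₙ) = c₁ • x₁ + ⋯ + cₙ • xₙ` with constants `cᵢ` in `R`. -/
def IsLinearFun (R : Type*) {G : Type*} [Ring R] [AddCommGroup G] [Module R G]
    {ι : Type*} [Fintype ι] (f : (ι → G) → G) : Prop :=
  ∃ c : ι → R, ∀ x : ι → G, f x = ∑ i, c i • x i

/-- The code is linear over the (left) `R`-module `G`. -/
def Code.IsLinear {N : Network} (R : Type*) {G : Type*} [Ring R] [AddCommGroup G] [Module R G]
    (C : N.Code G) : Prop :=
  (∀ e, IsLinearFun R (C.edgeFun e)) ∧ ∀ v m hm, IsLinearFun R (C.decodeFun v m hm)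

/-- The network has a linear solution over the (left) `R`-module `G`. -/
def LinearlySolvable (N : Network) (R G : Type*) [Ring R] [AddCommGroup G] [Module R G] : Prop :=
  ∃ C : N.Code G, C.IsLinear R ∧ C.IsSolution

/-- The network has a scalar linear solution over the ring `R`, that is, a linear solution over
`R` acting on its own additive group by left multiplication. -/
def ScalarLinearlySolvable (N : Network) (R : Type*) [Ring R] : Prop :=
  N.LinearlySolvable R R

end Network

/-!
A ring homomorphism `R → S` carries the coefficients of a linear solution over `R` to those of a
linear solution over `S` (`Network.ScalarLinearlySolvable.map`), so it is enough to find
homomorphisms from a ring `R` of order `pᵏ` to the rings in the statement. They come from the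
composition factors of `R` as a left module over itself, whose orders `pˢ` have exponents adding up
to `k`.

Let `S` be a simple left module of order `pˢ`. By Schur and Wedderburn its endomorphism ring `D` is
a finite field. If `S` is one-dimensional over `D`, then `R` acts on `S` through a field, giving
`R → GF(pˢ)`; this is always so for `s = 1`. Otherwise there are vectors `v ≠ 0` and `w` in `S` with
`w ∉ D v`, and `r ↦ (r v, r w)` maps `R` onto `S × S` (`exists_smul_eq_smul_eq`), so that `2 s ≤ k`
and the remaining factors account for the exponent `k - 2 s`.

With this dichotomy, and with the embeddings of `GF(pᵈ)` in `GF(pⁿ)` for `d ∣ n`, the exponents up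
to 5 are a matter of listing the possible composition factors; for `k = 4` a simple module of order
`p²` gives an action of `R` by `2 × 2` matrices over `GF(p)`. Two points need more when `k = 6`.
If `s = 3` and `R ≅ S × S` as left modules, then `S ≅ Hom(R, S) ≅ D × D` has square order, which is
impossible (`even_of_bijective_toSpanSingleton_prod`). If `s = 2` and `S` is two-dimensional over
`D`, the annihilator of `S` is a two-sided ideal `K` of order `p²`. If `K` is not simple as a left
module, there is a factor of order `p`; if it is, right multiplication maps `R` to its endomorphism
field, of order `p` or `p²`. In both cases `R` maps to `GF(p⁶)`.
-/

/-! ### Transfer of solutions along ring homomorphisms -/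

/-- A scalar linear solution over `R` is pushed forward by applying `φ` to all its coefficients. -/
theorem Network.ScalarLinearlySolvable.map {N : Network} {R S : Type*} [Ring R] [Ring S]
    (hN : N.ScalarLinearlySolvable R) (φ : R →+* S) : N.ScalarLinearlySolvable S := by
  classical
  obtain ⟨C, ⟨hE, hD⟩, hC⟩ := hN
  choose c hc using hE
  choose d hd using hD
  have : Fintype N.M := Fintype.ofFinite _
  -- `s m e` is the symbol on the edge `e` when the message `m` is `1` and all others are `0`.
  choose s hs hs' using fun m : N.M => hC (Pi.single m 1)
  refine ⟨⟨fun e x => ∑ i, φ (c e i) • x i, fun v m hm x => ∑ i, φ (d v m hm i) • x i⟩,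
    ⟨fun e => ⟨_, fun _ => rfl⟩, fun v m hm => ⟨_, fun _ => rfl⟩⟩, fun z => ?_⟩
  have key : ∀ v i, N.inputs z (fun e => ∑ m, φ (s m e) * z m) v i
      = ∑ m, φ (N.inputs (Pi.single m 1) (s m) v i) * z m := by
    rintro v (m' | e)
    · simp [Network.inputs, Pi.single_apply, apply_ite φ]
    · simp [Network.inputs]
  have comb : ∀ v (a : N.Input v → R),
      ∑ i, φ (a i) • N.inputs z (fun e => ∑ m, φ (s m e) * z m) v i
        = ∑ m, φ (∑ i, a i • N.inputs (Pi.single m 1) (s m) v i) * z m := by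
    intro v a
    simp only [key, smul_eq_mul, map_sum, map_mul, Finset.mul_sum, Finset.sum_mul, mul_assoc]
    exact Finset.sum_comm
  refine ⟨fun e => ∑ m, φ (s m e) * z m, fun e => ?_, fun v m hm => ?_⟩
  · refine Eq.trans ?_ (comb _ (c e)).symm
    refine Finset.sum_congr rfl fun m _ => ?_
    rw [hs m e, hc]
  · refine (comb _ (d v m hm)).trans ?_
    simp only [← hd, hs']
    simp [Pi.single_apply, apply_ite φ]

/-! ### Endomorphisms of finite simple modules -/

section Simple

universe u

variable {R : Type u} [Ring R] {S : Type*} [AddCommGroup S] [Module R S]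

theorem Module.End.mul_comm_of_finite_of_isSimpleModule [Finite S] [IsSimpleModule R S]
    (f g : Module.End R S) : f * g = g * f := by
  classical
  have : Finite (Module.End R S) := DFunLike.finite _
  exact (Finite.isDomain_to_isField (Module.End R S)).mul_comm f g

variable (R) in
theorem Module.End.eval_injective_of_isSimpleModule [IsSimpleModule R S] {v : S} (hv : v ≠ 0) :
    Function.Injective (LinearMap.evalAddMonoidHom v : Module.End R S →+ S) := by
  rw [injective_iff_map_eq_zero]
  intro f hf
  refine (LinearMap.injective_or_eq_zero f).resolve_left fun h => hv (h ?_)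
  simpa using hf

/-- A map to the endomorphisms of a finite simple module that reverses products is a homomorphism
to a finite field, and the order of that field divides the order of the module. -/
theorem exists_ringHom_galoisField_of_end {p : ℕ} [Fact p.Prime] [IsSimpleModule R S] {s : ℕ}
    (hS : Nat.card S = p ^ s) (φ : R →+ Module.End R S) (h1 : φ 1 = 1)
    (hmul : ∀ a b, φ (a * b) = φ b * φ a) :
    ∃ d ≠ 0, d ≤ s ∧ Nat.card (Module.End R S) = p ^ d ∧ Nonempty (R →+* GaloisField p d) := by
  classical
  have hp : p.Prime := Fact.out
  have : Finite S := Nat.finite_of_card_ne_zero (hS ▸ pow_ne_zero _ hp.ne_zero)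
  have : Finite (Module.End R S) := DFunLike.finite _
  have := IsSimpleModule.nontrivial R S
  obtain ⟨v, hv⟩ := exists_ne (0 : S)
  have hdvd : Nat.card (Module.End R S) ∣ p ^ s :=
    hS ▸ AddSubgroup.card_dvd_of_injective _ (Module.End.eval_injective_of_isSimpleModule R hv)
  obtain ⟨d, hd, hcard⟩ := (Nat.dvd_prime_pow hp).1 hdvd
  have hd0 : d ≠ 0 := by
    rintro rfl
    exact (Finite.one_lt_card (α := Module.End R S)).ne' (by simpa using hcard)
  let e : Module.End R S ≃+* GaloisField p d := by
    letI : Field (Module.End R S) := (Finite.isDomain_to_isField (Module.End R S)).toField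
    letI := Fintype.ofFinite (Module.End R S)
    letI := Fintype.ofFinite (GaloisField p d)
    exact FiniteField.ringEquivOfCardEq (by
      rw [Fintype.card_eq_nat_card, Fintype.card_eq_nat_card, hcard, GaloisField.card p d hd0])
  let ψ : R →+* Module.End R S :=
    { φ with
      map_one' := h1
      map_mul' := fun a b =>
        (hmul a b).trans (Module.End.mul_comm_of_finite_of_isSimpleModule _ _) }
  exact ⟨d, hd0, hd, hcard, ⟨(e : Module.End R S →+* GaloisField p d).comp ψ⟩⟩

/-- If the simple module `S` is one-dimensional over its endomorphism field, then `R` acts on `S`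
through that field. -/
theorem exists_ringHom_galoisField_of_eval_surjective {p : ℕ} [Fact p.Prime] [IsSimpleModule R S]
    {s : ℕ} (hS : Nat.card S = p ^ s) {v : S} (hv : v ≠ 0)
    (hsurj : ∀ x : S, ∃ f : Module.End R S, f v = x) :
    Nonempty (R →+* GaloisField p s) := by
  have hp : p.Prime := Fact.out
  have hinj := Module.End.eval_injective_of_isSimpleModule R hv
  let e : Module.End R S ≃+ S := AddEquiv.ofBijective (LinearMap.evalAddMonoidHom v) ⟨hinj, hsurj⟩
  have he : ∀ x, e.symm x v = x := fun x => e.apply_symm_apply x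
  obtain ⟨d, -, -, hcard, h⟩ := exists_ringHom_galoisField_of_end (R := R) hS
    { toFun := fun r => e.symm (r • v)
      map_zero' := by simp
      map_add' := fun a b => by rw [add_smul, map_add] } (hinj (by simp [he])) fun a b =>
        hinj (by simp [he, mul_smul])
  rw [Nat.card_congr e.toEquiv, hS] at hcard
  rwa [Nat.pow_right_injective hp.two_le hcard]

/-- The density theorem for two vectors: if no endomorphism of the simple module `S` takes `v` to
`w`, then a ring element can act on `v` and `w` in any prescribed way. -/
theorem exists_smul_eq_smul_eq [IsSimpleModule R S] {v w : S} (hv : v ≠ 0)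
    (hw : ∀ f : Module.End R S, f v ≠ w) (x y : S) : ∃ r : R, r • v = x ∧ r • w = y := by
  have hvs := IsSimpleModule.toSpanSingleton_surjective R hv
  -- The annihilator of `v` moves `w`, as otherwise `r • v ↦ r • w` would be well defined.
  have hann : (LinearMap.ker (LinearMap.toSpanSingleton R S v)).map
      (LinearMap.toSpanSingleton R S w) = ⊤ := by
    refine (eq_bot_or_eq_top _).resolve_left fun h => ?_
    have hle : LinearMap.ker (LinearMap.toSpanSingleton R S v)
        ≤ LinearMap.ker (LinearMap.toSpanSingleton R S w) := by
      rwa [← le_bot_iff, Submodule.map_le_iff_le_comap] at h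
    let e := (LinearMap.toSpanSingleton R S v).quotKerEquivOfSurjective hvs
    refine hw (((LinearMap.ker (LinearMap.toSpanSingleton R S v)).liftQ _ hle).comp
      (e.symm : S →ₗ[R] _)) ?_
    have : e.symm v = Submodule.Quotient.mk 1 := by
      rw [LinearEquiv.symm_apply_eq]
      simp [e, LinearMap.quotKerEquivOfSurjective]
    simp [this]
  obtain ⟨r, hr⟩ := hvs x
  obtain ⟨a, ha, haw⟩ := hann.ge (Submodule.mem_top (x := y - r • w))
  refine ⟨r + a, ?_, ?_⟩
  · simpa [add_smul, show a • v = 0 from ha] using hr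
  · simpa [add_smul, add_comm, eq_sub_iff_add_eq] using haw

/-- If the simple module `S` has more than one dimension over its endomorphism field, then `R` maps
onto `S × S`. -/
theorem exists_ringHom_galoisField_or_independent {p : ℕ} [Fact p.Prime] [IsSimpleModule R S]
    {s : ℕ} (hS : Nat.card S = p ^ s) :
    Nonempty (R →+* GaloisField p s) ∨
      ∃ v w : S, v ≠ 0 ∧ (∀ f : Module.End R S, f v ≠ w) ∧ Function.Surjective
        ((LinearMap.toSpanSingleton R S v).prod (LinearMap.toSpanSingleton R S w)) := by
  have := IsSimpleModule.nontrivial R S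
  obtain ⟨v, hv⟩ := exists_ne (0 : S)
  by_cases h : ∀ x : S, ∃ f : Module.End R S, f v = x
  · exact .inl (exists_ringHom_galoisField_of_eval_surjective hS hv h)
  · push Not at h
    obtain ⟨w, hw⟩ := h
    refine .inr ⟨v, w, hv, hw, fun ⟨x, y⟩ => ?_⟩
    obtain ⟨r, hr⟩ := exists_smul_eq_smul_eq hv hw x y
    exact ⟨r, by simpa using hr⟩

theorem card_eq_card_ker_mul_card {M N : Type*} [AddCommGroup M] [Module R M] [AddCommGroup N]
    [Module R N] {f : M →ₗ[R] N} (hf : Function.Surjective f) :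
    Nat.card M = Nat.card (LinearMap.ker f) * Nat.card N := by
  rw [Submodule.card_eq_card_quotient_mul_card (LinearMap.ker f),
    Nat.card_congr (f.quotKerEquivOfSurjective hf).toEquiv]

theorem card_ker_eq_pow {p : ℕ} [Fact p.Prime] {M N : Type*} [AddCommGroup M] [Module R M]
    [AddCommGroup N] [Module R N] {f : M →ₗ[R] N} (hf : Function.Surjective f) {k l : ℕ}
    (hM : Nat.card M = p ^ k) (hN : Nat.card N = p ^ l) :
    l ≤ k ∧ Nat.card (LinearMap.ker f) = p ^ (k - l) := by
  have hp : p.Prime := Fact.out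
  have h := card_eq_card_ker_mul_card hf
  rw [hM, hN] at h
  have hlk : l ≤ k := (Nat.pow_dvd_pow_iff_le_right hp.one_lt).1 (Dvd.intro_left _ h.symm)
  exact ⟨hlk, Nat.eq_of_mul_eq_mul_right (pow_pos hp.pos l)
    (by rw [← h, ← pow_add, Nat.sub_add_cancel hlk])⟩

end Simple

/-! ### Simple modules of small order -/

section Small

universe u

variable {R : Type u} [Ring R] {S : Type*} [AddCommGroup S] [Module R S] {p : ℕ} [Fact p.Prime]

/-- The endomorphism of a finite simple `p`-group given by multiplication by `p` is not injective,
so it vanishes. -/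
theorem prime_nsmul_eq_zero_of_isSimpleModule [IsSimpleModule R S] {s : ℕ}
    (hS : Nat.card S = p ^ s) (x : S) : p • x = 0 := by
  have hp : p.Prime := Fact.out
  have : Finite S := Nat.finite_of_card_ne_zero (hS ▸ pow_ne_zero _ hp.ne_zero)
  have := IsSimpleModule.nontrivial R S
  have hs : s ≠ 0 := by
    rintro rfl
    exact (Finite.one_lt_card (α := S)).ne' (by simpa using hS)
  obtain ⟨y, hy⟩ := exists_prime_addOrderOf_dvd_card' (G := S) p (hS ▸ dvd_pow_self p hs)
  rcases LinearMap.injective_or_eq_zero (p • LinearMap.id : S →ₗ[R] S) with h | h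
  · have hy0 : y = 0 := h (by simp [← hy, addOrderOf_nsmul_eq_zero])
    exact absurd hy (by simpa [hy0] using hp.one_lt.ne)
  · simpa using LinearMap.congr_fun h x

theorem nonempty_ringHom_matrix_of_smulCommClass {R S : Type*} [Ring R] [AddCommGroup S]
    [Module R S] [Module (ZMod p) S] [SMulCommClass R (ZMod p) S] {s : ℕ}
    (hS : Nat.card S = p ^ s) : Nonempty (R →+* Matrix (Fin s) (Fin s) (ZMod p)) := by
  have hp : p.Prime := Fact.out
  have : Finite S := Nat.finite_of_card_ne_zero (hS ▸ pow_ne_zero _ hp.ne_zero)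
  have hrank : Module.finrank (ZMod p) S = s := by
    have h := Module.natCard_eq_pow_finrank (K := ZMod p) (V := S)
    rw [hS, Nat.card_zmod] at h
    exact (Nat.pow_right_injective hp.two_le h).symm
  let b : Module.Basis (Fin s) (ZMod p) S := Module.finBasisOfFinrankEq (ZMod p) S hrank
  let e : Module.End (ZMod p) S ≃ₐ[ZMod p] Matrix (Fin s) (Fin s) (ZMod p) :=
    LinearMap.toMatrixAlgEquiv b
  exact ⟨e.toRingEquiv.toRingHom.comp (Module.toModuleEnd (ZMod p) S)⟩

theorem nonempty_ringHom_matrix_of_isSimpleModule [IsSimpleModule R S] {s : ℕ}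
    (hS : Nat.card S = p ^ s) : Nonempty (R →+* Matrix (Fin s) (Fin s) (ZMod p)) := by
  let _ : Module (ZMod p) S :=
    AddCommGroup.zmodModule (prime_nsmul_eq_zero_of_isSimpleModule (R := R) hS)
  have : SMulCommClass R (ZMod p) S := ⟨fun r a x => by
    obtain ⟨n, rfl⟩ := ZMod.natCast_zmod_surjective a
    rw [Nat.cast_smul_eq_nsmul, Nat.cast_smul_eq_nsmul, smul_comm]⟩
  exact nonempty_ringHom_matrix_of_smulCommClass hS

/-- A nonzero vector and a vector outside its `End`-orbit span a subgroup of order at least `p²`,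
for the orbit contains the multiples of the first vector. -/
theorem AddSubgroup.eq_top_of_mem_of_eval_ne {s : ℕ} (hS : Nat.card S = p ^ s) (hs : s ≤ 2)
    {v w : S} (hv : v ≠ 0) (hw : ∀ f : Module.End R S, f v ≠ w) {H : AddSubgroup S} (hvH : v ∈ H)
    (hwH : w ∈ H) : s = 2 ∧ H = ⊤ := by
  have hp : p.Prime := Fact.out
  have : Finite S := Nat.finite_of_card_ne_zero (hS ▸ pow_ne_zero _ hp.ne_zero)
  have hwv : w ∉ AddSubgroup.zmultiples v := by
    rintro ⟨n, hn⟩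
    exact hw (n • 1) (by simpa using hn)
  have hlt : AddSubgroup.zmultiples v < H :=
    lt_of_le_of_ne (AddSubgroup.zmultiples_le_of_mem hvH) fun h => hwv (h ▸ hwH)
  obtain ⟨i, hi, hiv⟩ := (Nat.dvd_prime_pow hp).1
    (hS ▸ AddSubgroup.card_addSubgroup_dvd_card (AddSubgroup.zmultiples v))
  obtain ⟨j, hj, hjH⟩ := (Nat.dvd_prime_pow hp).1 (hS ▸ AddSubgroup.card_addSubgroup_dvd_card H)
  have hi0 : i ≠ 0 := by
    rintro rfl
    exact hv (AddSubgroup.zmultiples_eq_bot.1 (AddSubgroup.card_eq_one.1 (by simpa using hiv)))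
  have hij : i < j := by
    rw [← Nat.pow_lt_pow_iff_right hp.one_lt, ← hiv, ← hjH]
    exact Set.Finite.card_lt_card (Set.toFinite _) hlt
  have hj2 : j = 2 ∧ s = 2 := by omega
  refine ⟨hj2.2, AddSubgroup.eq_top_of_card_eq H ?_⟩
  rw [hjH, hS, hj2.1, hj2.2]

/-- If `R` is the direct sum of two copies of the simple module `S`, then applying
`Hom(-, S)` shows that `S` is two-dimensional over its endomorphism field. -/
theorem even_of_bijective_toSpanSingleton_prod [IsSimpleModule R S] {s : ℕ}
    (hS : Nat.card S = p ^ s) {v w : S} (hv : v ≠ 0) (hbij : Function.Bijective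
      ((LinearMap.toSpanSingleton R S v).prod (LinearMap.toSpanSingleton R S w))) : Even s := by
  have hp : p.Prime := Fact.out
  let e := LinearEquiv.ofBijective _ hbij
  have he1 : e 1 = (v, w) := by simp [e]
  let ev : Module.End R S × Module.End R S → S := fun f => f.1 v + f.2 w
  have hev : Function.Bijective ev := by
    constructor
    · intro f g h
      have hact : ∀ r : R, f.1 (r • v) + f.2 (r • w) = g.1 (r • v) + g.2 (r • w) := fun r => by
        simpa [ev] using congrArg (r • ·) h
      have hact' : ∀ x y : S, f.1 x + f.2 y = g.1 x + g.2 y := fun x y => by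
        obtain ⟨r, hr⟩ := hbij.2 (x, y)
        obtain ⟨rfl, rfl⟩ : r • v = x ∧ r • w = y := by simpa using hr
        exact hact r
      refine Prod.ext (LinearMap.ext fun x => ?_) (LinearMap.ext fun y => ?_)
      · simpa using hact' x 0
      · simpa using hact' 0 y
    · intro x
      let g : S × S →ₗ[R] S := (LinearMap.toSpanSingleton R S x).comp (e.symm : S × S →ₗ[R] R)
      refine ⟨(g.comp (LinearMap.inl R S S), g.comp (LinearMap.inr R S S)), ?_⟩
      have hg : g (v, w) = x := by simp [g, ← he1]
      simp only [ev, LinearMap.comp_apply, ← map_add]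
      simpa using hg
  have hcard := Nat.card_congr (Equiv.ofBijective ev hev)
  obtain ⟨d, -, hd⟩ := (Nat.dvd_prime_pow hp).1 (hS ▸ AddSubgroup.card_dvd_of_injective _
    (Module.End.eval_injective_of_isSimpleModule R hv))
  rw [Nat.card_prod, hd, hS, ← pow_add] at hcard
  exact ⟨d, (Nat.pow_right_injective hp.two_le hcard).symm⟩

/-- If a two-sided ideal is simple as a left module, then right multiplication on it leads to a
homomorphism to a finite field. -/
theorem exists_ringHom_galoisField_of_isSimpleModule_ideal {K : Submodule R R} [IsSimpleModule R K]
    (hK : ∀ a ∈ K, ∀ r, a * r ∈ K) {s : ℕ} (hs : Nat.card K = p ^ s) :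
    ∃ d ≠ 0, d ≤ s ∧ Nonempty (R →+* GaloisField p d) := by
  let φ : R →+ Module.End R K :=
    { toFun := fun r =>
        { toFun := fun a => ⟨a * r, hK a a.2 r⟩
          map_add' := fun a b => Subtype.ext (add_mul _ _ _)
          map_smul' := fun t a => Subtype.ext (mul_assoc _ _ _) }
      map_zero' := LinearMap.ext fun a => Subtype.ext (mul_zero _)
      map_add' := fun r t => LinearMap.ext fun a => Subtype.ext (mul_add _ _ _) }
  obtain ⟨d, hd0, hd, -, h⟩ := exists_ringHom_galoisField_of_end hs φ
    (LinearMap.ext fun a => Subtype.ext (mul_one _))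
    fun r t => LinearMap.ext fun a => Subtype.ext (mul_assoc _ _ _).symm
  exact ⟨d, hd0, hd, h⟩

end Small

/-! ### Composition factors -/

section Factors

universe u

/-- There is a left `R`-module of order `q`. -/
def HasModuleOfCard (R : Type u) [Ring R] (q : ℕ) : Prop :=
  ∃ (M : Type u) (_ : AddCommGroup M) (_ : Module R M), Nat.card M = q

/-- There is a simple left `R`-module of order `q`. -/
def HasSimpleModuleOfCard (R : Type u) [Ring R] (q : ℕ) : Prop :=
  ∃ (M : Type u) (_ : AddCommGroup M) (_ : Module R M), IsSimpleModule R M ∧ Nat.card M = q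

variable {R : Type u} [Ring R] {p : ℕ} [Fact p.Prime]

theorem exists_isSimpleModule_submodule {M : Type*} [AddCommGroup M] [Module R M] {k : ℕ}
    (hM : Nat.card M = p ^ k) (hk : k ≠ 0) :
    ∃ N : Submodule R M, IsSimpleModule R N ∧ ∃ s ≠ 0, s ≤ k ∧ Nat.card N = p ^ s := by
  have hp : p.Prime := Fact.out
  have : Finite M := Nat.finite_of_card_ne_zero (hM ▸ pow_ne_zero _ hp.ne_zero)
  have : Nontrivial M := Finite.one_lt_card_iff_nontrivial.1 (hM ▸ Nat.one_lt_pow hk hp.one_lt)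
  obtain ⟨N, hN⟩ := IsAtomic.exists_atom (Submodule R M)
  have hNs : IsSimpleModule R N := isSimpleModule_iff_isAtom.2 hN
  have := IsSimpleModule.nontrivial R N
  obtain ⟨s, hs, hcard⟩ := (Nat.dvd_prime_pow hp).1
    (hM ▸ AddSubgroup.card_addSubgroup_dvd_card N.toAddSubgroup)
  refine ⟨N, hNs, s, ?_, hs, hcard⟩
  rintro rfl
  exact (Finite.one_lt_card (α := N)).ne' (by simpa using hcard)

/-- Splitting off a composition factor of a module of prime power order. -/
theorem HasModuleOfCard.exists_simple {k : ℕ} (h : HasModuleOfCard R (p ^ k)) (hk : k ≠ 0) :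
    ∃ s ≠ 0, s ≤ k ∧ HasSimpleModuleOfCard R (p ^ s) ∧ HasModuleOfCard R (p ^ (k - s)) := by
  obtain ⟨M, _, _, hM⟩ := h
  obtain ⟨N, hN, s, hs, hsk, hcard⟩ := exists_isSimpleModule_submodule (R := R) hM hk
  refine ⟨s, hs, hsk, ⟨N, _, _, hN, hcard⟩, M ⧸ N, inferInstance, inferInstance, ?_⟩
  have h := Submodule.card_eq_card_quotient_mul_card N
  rw [hM, hcard] at h
  have hp : p.Prime := Fact.out
  exact Nat.eq_of_mul_eq_mul_left (pow_pos hp.pos s)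
    (by rw [← h, ← pow_add, Nat.add_sub_cancel' hsk])

theorem HasModuleOfCard.hasSimpleModuleOfCard_prime (h : HasModuleOfCard R (p ^ 1)) :
    HasSimpleModuleOfCard R (p ^ 1) := by
  obtain ⟨s, hs, hs1, hT, -⟩ := h.exists_simple one_ne_zero
  obtain rfl : s = 1 := by omega
  exact hT

theorem HasSimpleModuleOfCard.nonempty_ringHom_prime (h : HasSimpleModuleOfCard R (p ^ 1)) :
    Nonempty (R →+* GaloisField p 1) := by
  obtain ⟨S, _, _, _, hS⟩ := h
  rcases exists_ringHom_galoisField_or_independent (R := R) hS with h | ⟨v, w, hv, hw, -⟩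
  · exact h
  · have := (AddSubgroup.eq_top_of_mem_of_eval_ne (H := ⊤) hS one_le_two hv hw trivial trivial).1
    omega

/-- A simple module that is not one-dimensional over its endomorphism field occurs at least twice
as a composition factor of `R`. -/
theorem HasSimpleModuleOfCard.nonempty_ringHom_or {k s : ℕ} (hR : Nat.card R = p ^ k)
    (h : HasSimpleModuleOfCard R (p ^ s)) :
    Nonempty (R →+* GaloisField p s) ∨ 2 * s ≤ k ∧ HasModuleOfCard R (p ^ (k - 2 * s)) := by
  obtain ⟨S, _, _, _, hS⟩ := h
  refine (exists_ringHom_galoisField_or_independent (R := R) hS).imp_right ?_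
  rintro ⟨v, w, -, -, hsurj⟩
  obtain ⟨hle, hker⟩ := card_ker_eq_pow hsurj hR
    (by rw [Nat.card_prod, hS, ← pow_add, ← two_mul] : Nat.card (S × S) = p ^ (2 * s))
  exact ⟨hle, _, inferInstance, inferInstance, hker⟩

theorem HasSimpleModuleOfCard.even_or_nonempty_ringHom {s : ℕ}
    (hR : Nat.card R = p ^ (2 * s)) (h : HasSimpleModuleOfCard R (p ^ s)) :
    Nonempty (R →+* GaloisField p s) ∨ Even s := by
  have hp : p.Prime := Fact.out
  obtain ⟨S, _, _, _, hS⟩ := h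
  refine (exists_ringHom_galoisField_or_independent (R := R) hS).imp_right ?_
  rintro ⟨v, w, hv, -, hsurj⟩
  have : Finite R := Nat.finite_of_card_ne_zero (hR ▸ pow_ne_zero _ hp.ne_zero)
  refine even_of_bijective_toSpanSingleton_prod hS hv
    ((Nat.bijective_iff_surjective_and_card _).2 ⟨hsurj, ?_⟩)
  rw [Nat.card_prod, hS, hR, ← pow_add, two_mul]

/-- In a ring of order `p⁶` with a simple module `S` of order `p²`, either `R` acts on `S` through
a field, or the annihilator of `S` is a two-sided ideal of order `p²`. In the latter case this
ideal, if simple as a left module, leads to a field by right multiplication. -/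
theorem HasSimpleModuleOfCard.exists_ringHom_of_card_pow_six (hR : Nat.card R = p ^ 6)
    (h : HasSimpleModuleOfCard R (p ^ 2)) :
    ∃ d ≠ 0, d ≤ 2 ∧ Nonempty (R →+* GaloisField p d) := by
  have hp : p.Prime := Fact.out
  have : Finite R := Nat.finite_of_card_ne_zero (hR ▸ pow_ne_zero _ hp.ne_zero)
  obtain ⟨S, _, _, _, hS⟩ := h
  rcases exists_ringHom_galoisField_or_independent (R := R) hS with h | ⟨v, w, hv, hw, hsurj⟩
  · exact ⟨2, two_ne_zero, le_rfl, h⟩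
  set K := LinearMap.ker ((LinearMap.toSpanSingleton R S v).prod (LinearMap.toSpanSingleton R S w))
    with hK
  have hmem : ∀ a, a ∈ K ↔ a • v = 0 ∧ a • w = 0 := fun a => by simp [hK]
  have hKcard : Nat.card K = p ^ 2 :=
    (card_ker_eq_pow hsurj hR
      (by rw [Nat.card_prod, hS, ← pow_add] : Nat.card (S × S) = p ^ 4)).2
  have hann : ∀ a ∈ K, ∀ x : S, a • x = 0 := fun a ha x => by
    have := (AddSubgroup.eq_top_of_mem_of_eval_ne
      (H := (DistribSMul.toAddMonoidHom S a).ker) hS le_rfl hv hw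
      ((hmem a).1 ha).1 ((hmem a).1 ha).2).2
    exact (this.ge (AddSubgroup.mem_top x) :)
  have htwo : ∀ a ∈ K, ∀ r, a * r ∈ K := fun a ha r =>
    (hmem _).2 ⟨by rw [mul_smul, hann a ha], by rw [mul_smul, hann a ha]⟩
  obtain ⟨N, hN, s, hs0, hs2, hNcard⟩ := exists_isSimpleModule_submodule (R := R) hKcard two_ne_zero
  obtain rfl | rfl : s = 1 ∨ s = 2 := by omega
  · exact ⟨1, one_ne_zero, one_le_two,
      HasSimpleModuleOfCard.nonempty_ringHom_prime ⟨N, _, _, hN, hNcard⟩⟩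
  · have hNtop : N = ⊤ := Submodule.toAddSubgroup_injective
      (AddSubgroup.eq_top_of_card_eq N.toAddSubgroup (hNcard.trans hKcard.symm))
    subst hNtop
    have : IsSimpleModule R K := IsSimpleModule.congr Submodule.topEquiv.symm
    exact exists_ringHom_galoisField_of_isSimpleModule_ideal htwo hKcard

theorem nonempty_ringHom_galoisField_of_dvd {d n : ℕ} (hd : d ≠ 0) (hn : n ≠ 0) (hdn : d ∣ n)
    (h : Nonempty (R →+* GaloisField p d)) : Nonempty (R →+* GaloisField p n) := by
  obtain ⟨φ⟩ := h
  obtain ⟨ψ⟩ := FiniteField.nonempty_algHom_of_finrank_dvd (F := ZMod p) (K := GaloisField p d)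
    (L := GaloisField p n) (by rwa [GaloisField.finrank p hd, GaloisField.finrank p hn])
  exact ⟨(ψ : GaloisField p d →+* GaloisField p n).comp φ⟩

end Factors

/-! ### Homomorphisms from rings of order at most `p⁶` -/

section Orders

universe u

variable {R : Type u} [Ring R] {p : ℕ} [Fact p.Prime]

theorem nonempty_ringHom_of_hasSimpleModuleOfCard_prime {n : ℕ} (hn : n ≠ 0)
    (h : HasSimpleModuleOfCard R (p ^ 1)) : Nonempty (R →+* GaloisField p n) :=
  nonempty_ringHom_galoisField_of_dvd one_ne_zero hn (one_dvd n) h.nonempty_ringHom_prime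

theorem nonempty_ringHom_of_card_pow_two (hR : Nat.card R = p ^ 2) :
    Nonempty (R →+* GaloisField p 2) := by
  have hM : HasModuleOfCard R (p ^ 2) := ⟨R, inferInstance, inferInstance, hR⟩
  obtain ⟨s, hs0, hs, hT, -⟩ := hM.exists_simple two_ne_zero
  obtain rfl | rfl : s = 1 ∨ s = 2 := by omega
  · exact nonempty_ringHom_of_hasSimpleModuleOfCard_prime two_ne_zero hT
  · exact (hT.nonempty_ringHom_or hR).resolve_right (by omega)

theorem nonempty_ringHom_of_card_pow_three (hR : Nat.card R = p ^ 3) :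
    Nonempty (R →+* GaloisField p 3) := by
  have hM : HasModuleOfCard R (p ^ 3) := ⟨R, inferInstance, inferInstance, hR⟩
  obtain ⟨s, hs0, hs, hT, hM'⟩ := hM.exists_simple three_ne_zero
  obtain rfl | rfl | rfl : s = 1 ∨ s = 2 ∨ s = 3 := by omega
  · exact nonempty_ringHom_of_hasSimpleModuleOfCard_prime three_ne_zero hT
  · exact nonempty_ringHom_of_hasSimpleModuleOfCard_prime three_ne_zero
      hM'.hasSimpleModuleOfCard_prime
  · exact (hT.nonempty_ringHom_or hR).resolve_right (by omega)

theorem nonempty_ringHom_of_card_pow_four (hR : Nat.card R = p ^ 4) :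
    Nonempty (R →+* GaloisField p 4) ∨ Nonempty (R →+* Matrix (Fin 2) (Fin 2) (ZMod p)) := by
  have hM : HasModuleOfCard R (p ^ 4) := ⟨R, inferInstance, inferInstance, hR⟩
  obtain ⟨s, hs0, hs, hT, hM'⟩ := hM.exists_simple four_ne_zero
  obtain rfl | rfl | rfl | rfl : s = 1 ∨ s = 2 ∨ s = 3 ∨ s = 4 := by omega
  · exact .inl (nonempty_ringHom_of_hasSimpleModuleOfCard_prime four_ne_zero hT)
  · obtain ⟨S, _, _, _, hS⟩ := hT
    exact .inr (nonempty_ringHom_matrix_of_isSimpleModule hS)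
  · exact .inl (nonempty_ringHom_of_hasSimpleModuleOfCard_prime four_ne_zero
      hM'.hasSimpleModuleOfCard_prime)
  · exact .inl ((hT.nonempty_ringHom_or hR).resolve_right (by omega))

theorem nonempty_ringHom_of_card_pow_five (hR : Nat.card R = p ^ 5) :
    Nonempty (R →+* GaloisField p 5) ∨ Nonempty (R →+* GaloisField p 3 × GaloisField p 2) := by
  have of_prime (h : HasSimpleModuleOfCard R (p ^ 1)) : Nonempty (R →+* GaloisField p 5) :=
    nonempty_ringHom_of_hasSimpleModuleOfCard_prime (by norm_num) h
  -- If the simple module of order `p²` does not give a field, it occurs twice, leaving order `p`.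
  have of_both (h2 : HasSimpleModuleOfCard R (p ^ 2)) (h3 : HasSimpleModuleOfCard R (p ^ 3)) :
      Nonempty (R →+* GaloisField p 5) ∨ Nonempty (R →+* GaloisField p 3 × GaloisField p 2) := by
    obtain ⟨φ⟩ := (h3.nonempty_ringHom_or hR).resolve_right (by omega)
    rcases h2.nonempty_ringHom_or hR with ⟨⟨ψ⟩⟩ | ⟨-, h⟩
    · exact .inr ⟨φ.prod ψ⟩
    · exact .inl (of_prime h.hasSimpleModuleOfCard_prime)
  have hM : HasModuleOfCard R (p ^ 5) := ⟨R, inferInstance, inferInstance, hR⟩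
  obtain ⟨s, hs0, hs, hT, hM'⟩ := hM.exists_simple (by norm_num)
  obtain rfl | rfl | rfl | rfl | rfl : s = 1 ∨ s = 2 ∨ s = 3 ∨ s = 4 ∨ s = 5 := by omega
  · exact .inl (of_prime hT)
  · obtain ⟨t, ht0, ht, hT', hM''⟩ := hM'.exists_simple (by norm_num)
    obtain rfl | rfl | rfl : t = 1 ∨ t = 2 ∨ t = 3 := by omega
    · exact .inl (of_prime hT')
    · exact .inl (of_prime hM''.hasSimpleModuleOfCard_prime)
    · exact of_both hT hT'
  · obtain ⟨t, ht0, ht, hT', hM''⟩ := hM'.exists_simple (by norm_num)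
    obtain rfl | rfl : t = 1 ∨ t = 2 := by omega
    · exact .inl (of_prime hT')
    · exact of_both hT' hT
  · exact .inl (of_prime hM'.hasSimpleModuleOfCard_prime)
  · exact .inl ((hT.nonempty_ringHom_or hR).resolve_right (by omega))

theorem nonempty_ringHom_of_card_pow_six (hR : Nat.card R = p ^ 6) :
    Nonempty (R →+* GaloisField p 6) := by
  have of_prime (h : HasSimpleModuleOfCard R (p ^ 1)) : Nonempty (R →+* GaloisField p 6) :=
    nonempty_ringHom_of_hasSimpleModuleOfCard_prime (by norm_num) h
  have of_sq (h : HasSimpleModuleOfCard R (p ^ 2)) : Nonempty (R →+* GaloisField p 6) := by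
    obtain ⟨d, hd0, hd, hφ⟩ := h.exists_ringHom_of_card_pow_six hR
    refine nonempty_ringHom_galoisField_of_dvd hd0 (by norm_num) ?_ hφ
    obtain rfl | rfl : d = 1 ∨ d = 2 := by omega
    all_goals norm_num
  have hM : HasModuleOfCard R (p ^ 6) := ⟨R, inferInstance, inferInstance, hR⟩
  obtain ⟨s, hs0, hs, hT, hM'⟩ := hM.exists_simple (by norm_num)
  obtain rfl | rfl | rfl | rfl | rfl | rfl :
    s = 1 ∨ s = 2 ∨ s = 3 ∨ s = 4 ∨ s = 5 ∨ s = 6 := by omega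
  · exact of_prime hT
  · exact of_sq hT
  · refine nonempty_ringHom_galoisField_of_dvd three_ne_zero (by norm_num) (by norm_num)
      ((hT.even_or_nonempty_ringHom hR).resolve_right (by decide))
  · obtain ⟨t, ht0, ht, hT', -⟩ := hM'.exists_simple (by norm_num)
    obtain rfl | rfl : t = 1 ∨ t = 2 := by omega
    · exact of_prime hT'
    · exact of_sq hT'
  · exact of_prime hM'.hasSimpleModuleOfCard_prime
  · exact (hT.nonempty_ringHom_or hR).resolve_right (by omega)

end Orders

theorem theorem4p13 (p : ℕ) [Fact p.Prime] (N : Network) (R : Type*) [Ring R]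
    (hN : N.ScalarLinearlySolvable R) :
    (Nat.card R = p ^ 2 → N.ScalarLinearlySolvable (GaloisField p 2)) ∧
    (Nat.card R = p ^ 3 → N.ScalarLinearlySolvable (GaloisField p 3)) ∧
    (Nat.card R = p ^ 4 → N.ScalarLinearlySolvable (GaloisField p 4) ∨
      N.ScalarLinearlySolvable (Matrix (Fin 2) (Fin 2) (ZMod p))) ∧
    (Nat.card R = p ^ 5 → N.ScalarLinearlySolvable (GaloisField p 5) ∨
      N.ScalarLinearlySolvable (GaloisField p 3 × GaloisField p 2)) ∧
    (Nat.card R = p ^ 6 → N.ScalarLinearlySolvable (GaloisField p 6)) := by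
  refine ⟨fun h => ?_, fun h => ?_, fun h => ?_, fun h => ?_, fun h => ?_⟩
  · exact (nonempty_ringHom_of_card_pow_two h).elim hN.map
  · exact (nonempty_ringHom_of_card_pow_three h).elim hN.map
  · exact (nonempty_ringHom_of_card_pow_four h).imp (·.elim hN.map) (·.elim hN.map)
  · exact (nonempty_ringHom_of_card_pow_five h).imp (·.elim hN.map) (·.elim hN.map)
  · exact (nonempty_ringHom_of_card_pow_six h).elim hN.map
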